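/- Let $k$ be an arbitrary field, $P=k[x,y]$ and $R=k[\![x,y]\!]$, with the lexicographic order $x>y$ on monomials. The local lex order $\overline{\tau}$ on monomials is defined by $m>_{\overline{\tau}}m'$ if and only if $\deg m<\deg m'$, or $\deg m=\deg m'$ and $m>_{\mathrm{lex}}m'$; the leading monomial $\operatorname{Lt}_{\overline{\tau}}(f)$ of a nonzero $f\in R$ is the $\overline{\tau}$-largest monomial in its support. For an ideal $J\subset R$, let $\operatorname{Lt}_{\overline{\tau}}(J)\subset P$ be the monomial ideal generated by the leading monomials of the nonzero elements of $J$. A reduced $\overline{\tau}$-enhanced standard basis of $J$ is a finite set $F\subset J$ of nonzero series with leading coefficient $1$ whose leading monomials generate $\operatorname{Lt}_{\overline{\tau}}(J)$, such that no leading monomial of an element of $F$ divides the leading monomial of another element, and no non-leading monomial in the support of an element of $F$ is divisible by the leading monomial of an element of $F$. Let $0=m_0<m_1\le\dots\le m_t$ be integers, and let $$E=(x^t,x^{t-1}y^{m_1},\dots,x^{t-i}y^{m_i},\dots,y^{m_t})\subset P.$$ Suppose that $m_j-j-1\le m_i-i$ for all $0\le j<i\le t$. Let $J\subset R$ be an ideal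 with $\operatorname{Lt}_{\overline{\tau}}(J)=E$ (that is, $J\in V(E)$), and let $I=J\cap P$. Then $J$ has exactly one reduced $\overline{\tau}$-enhanced standard basis; it consists of polynomials and is a Gröbner basis of $I$ with respect to the lexicographic order (that is, it is contained in $I$ and its lex leading terms generate $\operatorname{Lt}_{\mathrm{lex}}(I)$), and $\operatorname{Lt}_{\mathrm{lex}}(I)=E$. -/

import Mathlib

/-- The local degree ordering induced by a global term order `τ`, on exponent vectors:
`LocalLT τ a b` says that the monomial with exponent `a` is strictly smaller than the monomial
with exponent `b`, i.e. `a` has larger total degree, or the same total degree and `a <_τ b`. -/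
def LocalLT {σ : Type*} (τ : MonomialOrder σ) (a b : σ →₀ ℕ) : Prop :=
  b.degree < a.degree ∨ (a.degree = b.degree ∧ τ.toSyn a < τ.toSyn b)

/-- `e` is the exponent of the leading monomial of the power series `f` with respect to the local
degree ordering induced by `τ`: the largest exponent in the support of `f`. (The zero series
has none; a nonzero one has exactly one, see `existsUnique_isLocalLeadingExp`.) -/
def IsLocalLeadingExp {σ k : Type*} [Field k] (τ : MonomialOrder σ)
    (f : MvPowerSeries σ k) (e : σ →₀ ℕ) : Prop :=
  MvPowerSeries.coeff e f ≠ 0 ∧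
    ∀ a : σ →₀ ℕ, MvPowerSeries.coeff a f ≠ 0 → a ≠ e → LocalLT τ a e

theorem existsUnique_isLocalLeadingExp {σ k : Type*} [Finite σ] [Field k] (τ : MonomialOrder σ)
    {f : MvPowerSeries σ k} (hf : f ≠ 0) : ∃! e : σ →₀ ℕ, IsLocalLeadingExp τ f e := by
  classical
  have h0 : ∃ d : ℕ, ∃ a : σ →₀ ℕ, a.degree = d ∧ MvPowerSeries.coeff a f ≠ 0 := by
    by_contra! h
    exact hf (MvPowerSeries.ext fun a => by simpa using h _ a rfl)
  obtain ⟨a₀, ha₀, hfa₀⟩ := Nat.find_spec h0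
  have hfin : {a : σ →₀ ℕ | a.degree = Nat.find h0 ∧ MvPowerSeries.coeff a f ≠ 0}.Finite :=
    (Finsupp.finite_of_degree_le (Nat.find h0)).subset fun a ha => ha.1.le
  obtain ⟨e, he, hmax⟩ := Set.exists_max_image _ (fun a => τ.toSyn a) hfin ⟨a₀, ha₀, hfa₀⟩
  refine ⟨e, ⟨he.2, fun a ha hne => ?_⟩, fun b hb => ?_⟩
  · have h1 : Nat.find h0 ≤ a.degree := Nat.find_min' h0 ⟨a, rfl, ha⟩
    rcases h1.lt_or_eq with h2 | h2
    · exact Or.inl (he.1 ▸ h2)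
    · exact Or.inr ⟨by rw [he.1, h2],
        lt_of_le_of_ne (hmax a ⟨h2.symm, ha⟩) fun h => hne (τ.toSyn.injective h)⟩
  · by_contra hbe
    have h1 : Nat.find h0 ≤ b.degree := Nat.find_min' h0 ⟨b, rfl, hb.1⟩
    rcases hb.2 e he.2 (Ne.symm hbe) with h2 | ⟨h2, h3⟩
    · exact absurd h1 (not_le.mpr (he.1 ▸ h2))
    · exact absurd (hmax b ⟨h2 ▸ he.1, hb.1⟩) (not_le.mpr h3)

/-- The monomial ideal of the polynomial ring generated by the leading monomials, with respect to
the local degree ordering induced by `τ`, of the (nonzero) elements of a set of power series. -/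
noncomputable def localLeadingIdeal {σ k : Type*} [Field k] (τ : MonomialOrder σ)
    (S : Set (MvPowerSeries σ k)) : Ideal (MvPolynomial σ k) :=
  Ideal.span {p | ∃ f ∈ S, ∃ e, IsLocalLeadingExp τ f e ∧ p = MvPolynomial.monomial e 1}

/-- The ideals `J` of the power series ring with leading term ideal `E` with respect to the local
lex ordering. -/
def cellV {σ k : Type*} [LinearOrder σ] [WellFoundedGT σ] [Field k]
    (E : Ideal (MvPolynomial σ k)) : Set (Ideal (MvPowerSeries σ k)) :=
  {J | localLeadingIdeal (MonomialOrder.lex (σ := σ)) (J : Set (MvPowerSeries σ k)) = E}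

/-- `F` is an enhanced standard basis of `J` with respect to the local degree ordering induced
by `τ`. -/
def IsEnhancedStandardBasis {σ k : Type*} [Field k] (τ : MonomialOrder σ)
    (J : Ideal (MvPowerSeries σ k)) (F : Finset (MvPowerSeries σ k)) : Prop :=
  (∀ f ∈ F, f ∈ J) ∧
    localLeadingIdeal τ (F : Set (MvPowerSeries σ k)) =
      localLeadingIdeal τ (J : Set (MvPowerSeries σ k))

/-- `F` is a reduced enhanced standard basis of `J`: every element is nonzero with leading
coefficient `1`, no leading monomial divides the leading monomial of another element, and no
non-leading monomial of an element is divisible by a leading monomial of an element of `F`. -/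
def IsReducedEnhancedStandardBasis {σ k : Type*} [Field k] (τ : MonomialOrder σ)
    (J : Ideal (MvPowerSeries σ k)) (F : Finset (MvPowerSeries σ k)) : Prop :=
  IsEnhancedStandardBasis τ J F ∧
  (∀ f ∈ F, ∃ e, IsLocalLeadingExp τ f e ∧ MvPowerSeries.coeff e f = 1) ∧
  (∀ f ∈ F, ∀ g ∈ F, f ≠ g → ∀ a b, IsLocalLeadingExp τ f a → IsLocalLeadingExp τ g b →
    ¬ b ≤ a) ∧
  (∀ f ∈ F, ∀ g ∈ F, ∀ a b, IsLocalLeadingExp τ f a → IsLocalLeadingExp τ g b →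
    ∀ c, MvPowerSeries.coeff c f ≠ 0 → c ≠ a → ¬ b ≤ c)

/-- The leading term ideal of an ideal of the polynomial ring with respect to a term order. -/
noncomputable def leadingIdeal {σ k : Type*} [Field k] (τ : MonomialOrder σ)
    (I : Ideal (MvPolynomial σ k)) : Ideal (MvPolynomial σ k) :=
  Ideal.span (τ.leadingTerm '' (I : Set (MvPolynomial σ k)))

/-- `G` is a Gröbner basis of `I` with respect to the term order `τ`. -/
def IsGroebnerBasis {σ k : Type*} [Field k] (τ : MonomialOrder σ)
    (I : Ideal (MvPolynomial σ k)) (G : Finset (MvPolynomial σ k)) : Prop :=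
  (∀ g ∈ G, g ∈ I) ∧
    Ideal.span (τ.leadingTerm '' (G : Set (MvPolynomial σ k))) = leadingIdeal τ I

/-- The contraction `J ∩ P` of an ideal of the power series ring to the polynomial ring. -/
noncomputable def contraction {σ k : Type*} [Field k] (J : Ideal (MvPowerSeries σ k)) :
    Ideal (MvPolynomial σ k) :=
  J.comap (MvPolynomial.coeToMvPowerSeries.ringHom (σ := σ) (R := k))

/-- The ideal `(x ^ t, x ^ (t - 1) * y ^ m 1, …, x ^ (t - i) * y ^ m i, …, y ^ m t)` of `k[x, y]`,
where `x = X 0` and `y = X 1`. With `MonomialOrder.lex` on `Fin 2` we have `x > y`. -/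
noncomputable def stairIdeal (k : Type*) [Field k] (t : ℕ) (m : Fin (t + 1) → ℕ) :
    Ideal (MvPolynomial (Fin 2) k) :=
  Ideal.span (Set.range fun i : Fin (t + 1) =>
    (MvPolynomial.X 0 ^ (t - (i : ℕ)) * MvPolynomial.X 1 ^ m i : MvPolynomial (Fin 2) k))

/-! The ideal `E` contains every monomial of degree at least `t + m_t`. By Nakayama's lemma `J` then
contains every series of order at least `t + m_t` (`orderIdeal_le`), so reduction modulo `J`
terminates and produces polynomials. Each minimal exponent `e` of `E` thus gives a polynomial `p e`
in `J` with leading term `e` and all other monomials outside `E` (`exists_reduced_polynomial`). A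
difference of two such series lies in `J` with support outside `E`, hence vanishes; therefore the `p
e` form the only reduced enhanced standard basis (`isReducedEnhancedStandardBasis_iff`).

The slope condition enters only in `lex_lt_stairExp`: a tail monomial of `p e` has at least the
degree of `e`, yet it lies outside `E`, and this forces it to be lex-smaller than `e`. So `p e` has
the same leading monomial for both orders. Lex division of an element of `I` by the `p e` leaves a
remainder in `J` supported outside `E`, which is zero, and so the lex leading monomial lies in `E`
(`degree_mem_localLeadingExps`). -/

/-- The exponents of the leading monomials of the elements of a set of power series. -/
def localLeadingExps {σ k : Type*} [Field k] (τ : MonomialOrder σ)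
    (A : Set (MvPowerSeries σ k)) : Set (σ →₀ ℕ) :=
  {e | ∃ f ∈ A, IsLocalLeadingExp τ f e}

/-- The ideal of the power series without terms of degree less than `n`. -/
def orderIdeal (σ k : Type*) [Field k] (n : ℕ) : Ideal (MvPowerSeries σ k) where
  carrier := {f | ∀ a : σ →₀ ℕ, a.degree < n → MvPowerSeries.coeff a f = 0}
  add_mem' hf hg a ha := by rw [map_add, hf a ha, hg a ha, add_zero]
  zero_mem' a _ := map_zero _
  smul_mem' c f hf a ha := by
    classical
    rw [smul_eq_mul, MvPowerSeries.coeff_mul]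
    refine Finset.sum_eq_zero fun p hp => ?_
    rw [hf p.2, mul_zero]
    have h : p.1.degree + p.2.degree = a.degree := by
      rw [← map_add, Finset.HasAntidiagonal.mem_antidiagonal.mp hp]
    omega

/-! ### Reduction modulo an ideal of power series, and reduced standard bases -/

section General

variable {σ k : Type*} [Field k] {τ : MonomialOrder σ}

/-- Assign each nonconstant monomial to one variable dividing it; collecting by variable writes `f`
as a sum of `X i * g i` with the order dropping by one. This prepares Nakayama's lemma in
`orderIdeal_le`. -/
theorem orderIdeal_succ_le [Finite σ] (n : ℕ) :
    orderIdeal σ k (n + 1) ≤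
      IsLocalRing.maximalIdeal (MvPowerSeries σ k) • orderIdeal σ k n := by
  classical
  cases nonempty_fintype σ
  intro f hf
  -- The value `none` serves the exponent `0`, which no variable divides; `σ` may even be empty.
  have hpick : ∀ a : σ →₀ ℕ, ∃ i : Option σ, ∀ ha : a ≠ 0, ∃ j, i = some j ∧ a j ≠ 0 := by
    intro a
    by_cases ha : a = 0
    · exact ⟨none, fun h => absurd ha h⟩
    · obtain ⟨j, hj⟩ := Finsupp.ne_iff.mp ha
      exact ⟨some j, fun _ => ⟨j, rfl, hj⟩⟩
  choose v hv using hpick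
  let g : σ → MvPowerSeries σ k := fun i a =>
    if v (a + Finsupp.single i 1) = some i then MvPowerSeries.coeff (a + Finsupp.single i 1) f
    else 0
  have hg : ∀ i a, MvPowerSeries.coeff a (g i) =
      if v (a + Finsupp.single i 1) = some i then
        MvPowerSeries.coeff (a + Finsupp.single i 1) f else 0 := fun _ _ => rfl
  have hcoeff : ∀ i a, MvPowerSeries.coeff a (MvPowerSeries.X i * g i) =
      if v a = some i ∧ a ≠ 0 then MvPowerSeries.coeff a f else 0 := by
    intro i a
    rw [MvPowerSeries.X, MvPowerSeries.coeff_monomial_mul, one_mul, hg]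
    by_cases h : Finsupp.single i 1 ≤ a
    · have ha : a ≠ 0 := by
        rintro rfl
        simpa using h i
      rw [if_pos h, tsub_add_cancel_of_le h]
      simp [ha]
    · rw [if_neg h, if_neg]
      rintro ⟨h1, h2⟩
      obtain ⟨j, hj, hj'⟩ := hv a h2
      obtain rfl : i = j := by simpa [h1] using hj
      exact h (Finsupp.single_le_iff.mpr (Nat.one_le_iff_ne_zero.mpr hj'))
  have hsum : f = ∑ i, MvPowerSeries.X i * g i := by
    ext a
    rw [map_sum, Finset.sum_congr rfl fun i _ => hcoeff i a]
    by_cases ha : a = 0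
    · subst ha
      simpa using hf 0 (by simp)
    · obtain ⟨j, hj, -⟩ := hv a ha
      simp [hj, ha]
  rw [hsum]
  refine sum_mem fun i _ => Submodule.smul_mem_smul ?_ fun a ha => ?_
  · rw [IsLocalRing.mem_maximalIdeal, mem_nonunits_iff, MvPowerSeries.isUnit_iff_constantCoeff]
    simp
  · rw [hg]
    split_ifs
    · exact hf _ (by simpa [map_add] using ha)
    · rfl

theorem LocalLT.add_left {a b : σ →₀ ℕ} (h : LocalLT τ a b) (c : σ →₀ ℕ) :
    LocalLT τ (c + a) (c + b) := by
  rcases h with h | ⟨h, h'⟩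
  · exact Or.inl (by simpa [map_add] using h)
  · exact Or.inr ⟨by simp [map_add, h], by simpa [map_add] using h'⟩

theorem IsLocalLeadingExp.monomial_mul {f : MvPowerSeries σ k} {e : σ →₀ ℕ}
    (h : IsLocalLeadingExp τ f e) (c : σ →₀ ℕ) :
    IsLocalLeadingExp τ (MvPowerSeries.monomial c 1 * f) (c + e) := by
  classical
  refine ⟨by simpa [MvPowerSeries.coeff_add_monomial_mul] using h.1, fun a ha hne => ?_⟩
  rw [MvPowerSeries.coeff_monomial_mul] at ha
  split_ifs at ha with hca
  · obtain ⟨b, rfl⟩ := exists_add_of_le hca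
    rw [add_tsub_cancel_left, one_mul] at ha
    exact (h.2 b ha fun hb => hne (by rw [hb])).add_left c
  · exact absurd rfl ha

theorem IsLocalLeadingExp.unique [Finite σ] {f : MvPowerSeries σ k} {a b : σ →₀ ℕ}
    (ha : IsLocalLeadingExp τ f a) (hb : IsLocalLeadingExp τ f b) : a = b := by
  have hf : f ≠ 0 := by
    rintro rfl
    exact ha.1 (map_zero _)
  exact (existsUnique_isLocalLeadingExp τ hf).unique ha hb

theorem isUpperSet_localLeadingExps (J : Ideal (MvPowerSeries σ k)) :
    IsUpperSet (localLeadingExps τ (J : Set (MvPowerSeries σ k))) := by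
  rintro a b hab ⟨f, hf, hfa⟩
  obtain ⟨c, rfl⟩ := exists_add_of_le hab
  exact ⟨_, J.mul_mem_left _ hf, by simpa [add_comm] using hfa.monomial_mul c⟩

theorem localLeadingIdeal_eq_span (A : Set (MvPowerSeries σ k)) :
    localLeadingIdeal τ A = Ideal.span
      ((fun s => MvPolynomial.monomial s (1 : k)) '' localLeadingExps τ A) := by
  rw [localLeadingIdeal]
  congr 1
  ext p
  constructor
  · rintro ⟨f, hf, e, he, rfl⟩
    exact ⟨e, ⟨f, hf, he⟩, rfl⟩
  · rintro ⟨e, ⟨f, hf, he⟩, rfl⟩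
    exact ⟨f, hf, e, he, rfl⟩

theorem monomial_mem_span_monomial_image {S : Set (σ →₀ ℕ)} {a : σ →₀ ℕ} :
    MvPolynomial.monomial a (1 : k) ∈
      Ideal.span ((fun s => MvPolynomial.monomial s (1 : k)) '' S) ↔ ∃ s ∈ S, s ≤ a := by
  classical
  rw [MvPolynomial.mem_ideal_span_monomial_image]
  simp [MvPolynomial.support_monomial]

theorem eq_zero_of_support_disjoint [Finite σ] {J : Ideal (MvPowerSeries σ k)}
    {f : MvPowerSeries σ k} (hf : f ∈ J)
    (h : ∀ c, MvPowerSeries.coeff c f ≠ 0 →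
      c ∉ localLeadingExps τ (J : Set (MvPowerSeries σ k))) : f = 0 := by
  by_contra hne
  obtain ⟨e, he, -⟩ := existsUnique_isLocalLeadingExp τ hne
  exact h e he.1 ⟨f, hf, he⟩

/-- Replace a leading monomial of `J` by minus the tail of a monic element of `J`, and recurse on
the tail. Working modulo `K` allows truncation at degree `n`, which makes the descent finite. `K` is
separate from `J` because the lemma is needed for `J ⊔ orderIdeal σ k (n + 1)` before `orderIdeal σ
k n ≤ J` is known. -/
theorem exists_normalForm_monomial [Finite σ] {J K : Ideal (MvPowerSeries σ k)} (hJK : J ≤ K)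
    {n : ℕ} (hn : orderIdeal σ k n ≤ K) (a : σ →₀ ℕ) :
    ∃ r : MvPolynomial σ k,
      (∀ c, r.coeff c ≠ 0 → c ∉ localLeadingExps τ (J : Set (MvPowerSeries σ k)) ∧
        (c = a ∨ LocalLT τ c a)) ∧
      MvPowerSeries.monomial a 1 - (r : MvPowerSeries σ k) ∈ K := by
  classical
  -- Below degree `n`, a locally smaller monomial has smaller `n - degree`, or equal degree and
  -- smaller `τ`-value.
  induction h : (toLex (n - a.degree, τ.toSyn a) : ℕ ×ₗ τ.syn) using
    WellFoundedLT.induction generalizing a with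
  | ind x ih =>
  subst h
  by_cases haS : a ∈ localLeadingExps τ (J : Set (MvPowerSeries σ k))
  swap
  · refine ⟨MvPolynomial.monomial a 1, fun c hc => ?_, by simp⟩
    rw [MvPolynomial.coeff_monomial] at hc
    obtain rfl : a = c := by
      by_contra hne
      exact hc (if_neg hne)
    exact ⟨haS, Or.inl rfl⟩
  by_cases hdeg : n ≤ a.degree
  · refine ⟨0, fun c hc => absurd (MvPolynomial.coeff_zero c) hc, hn fun b hb => ?_⟩
    have : b ≠ a := by
      rintro rfl
      omega
    simp [MvPowerSeries.coeff_monomial, this]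
  obtain ⟨f, hfJ, hfa⟩ := haS
  set u := MvPowerSeries.coeff a f with hu
  have hu0 : u ≠ 0 := hfa.1
  set h : MvPowerSeries σ k := u⁻¹ • f - MvPowerSeries.monomial a 1 with hh
  have hsupp : ∀ c, MvPowerSeries.coeff c h ≠ 0 → LocalLT τ c a := by
    intro c hc
    have hca : c ≠ a := by
      rintro rfl
      apply hc
      simp [hh, ← hu, hu0]
    refine hfa.2 c (fun h0 => hc ?_) hca
    simp [hh, h0, MvPowerSeries.coeff_monomial, hca]
  set q := MvPowerSeries.truncTotal n h with hq
  have hqc : ∀ c ∈ q.support, LocalLT τ c a ∧ c.degree < n := by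
    intro c hc
    rw [MvPolynomial.mem_support_iff, hq, MvPowerSeries.coeff_truncTotal_eq_ite] at hc
    split_ifs at hc with hcn
    · exact ⟨hsupp c hc, hcn⟩
    · exact absurd rfl hc
  have hred : ∀ c ∈ q.support, ∃ r : MvPolynomial σ k,
      (∀ d, r.coeff d ≠ 0 → d ∉ localLeadingExps τ (J : Set (MvPowerSeries σ k)) ∧
        LocalLT τ d a) ∧
      MvPowerSeries.monomial c 1 - (r : MvPowerSeries σ k) ∈ K := by
    intro c hc
    obtain ⟨hca, hcn⟩ := hqc c hc
    have hlt : (toLex (n - c.degree, τ.toSyn c) : ℕ ×ₗ τ.syn) <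
        toLex (n - a.degree, τ.toSyn a) := by
      rw [Prod.Lex.toLex_lt_toLex]
      rcases hca with h1 | ⟨h1, h2⟩
      · exact Or.inl (by simp only; omega)
      · exact Or.inr ⟨by simp only; omega, h2⟩
    obtain ⟨r, hr, hrK⟩ := ih _ hlt c rfl
    refine ⟨r, fun d hd => ⟨(hr d hd).1, ?_⟩, hrK⟩
    rcases (hr d hd).2 with rfl | hdc
    · exact hca
    · rcases hdc with h1 | ⟨h1, h2⟩ <;> rcases hca with h3 | ⟨h3, h4⟩
      · exact Or.inl (h3.trans h1)
      · exact Or.inl (h3 ▸ h1)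
      · exact Or.inl (h1 ▸ h3)
      · exact Or.inr ⟨h1.trans h3, h2.trans h4⟩
  choose! r hr hrK using hred
  refine ⟨-∑ c ∈ q.support, q.coeff c • r c, fun d hd => ?_, ?_⟩
  · rw [MvPolynomial.coeff_neg, MvPolynomial.coeff_sum] at hd
    obtain ⟨c, hc, hcd⟩ := Finset.exists_ne_zero_of_sum_ne_zero (neg_ne_zero.mp hd)
    rw [MvPolynomial.coeff_smul] at hcd
    have := hr c hc d (right_ne_zero_of_mul hcd)
    exact ⟨this.1, Or.inr this.2⟩
  · have hqsum : (q : MvPowerSeries σ k) =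
        ∑ c ∈ q.support, q.coeff c • MvPowerSeries.monomial c (1 : k) := by
      conv_lhs => rw [q.as_sum]
      rw [← MvPolynomial.coeToMvPowerSeries.ringHom_apply, map_sum]
      refine Finset.sum_congr rfl fun c _ => ?_
      rw [MvPolynomial.coeToMvPowerSeries.ringHom_apply, MvPolynomial.coe_monomial,
        ← map_smul, smul_eq_mul, mul_one]
    have hrsum : ((-∑ c ∈ q.support, q.coeff c • r c : MvPolynomial σ k) : MvPowerSeries σ k) =
        -∑ c ∈ q.support, q.coeff c • (r c : MvPowerSeries σ k) := by
      rw [← MvPolynomial.coeToMvPowerSeries.ringHom_apply, map_neg, map_sum]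
      simp
    have key : MvPowerSeries.monomial a (1 : k) -
        ((-∑ c ∈ q.support, q.coeff c • r c : MvPolynomial σ k) : MvPowerSeries σ k) =
        u⁻¹ • f - (h - q) - ∑ c ∈ q.support,
          q.coeff c • (MvPowerSeries.monomial c (1 : k) - (r c : MvPowerSeries σ k)) := by
      simp only [smul_sub, Finset.sum_sub_distrib]
      rw [← hqsum, hrsum, hh]
      abel
    rw [key]
    refine sub_mem (sub_mem (Submodule.smul_of_tower_mem _ _ (hJK hfJ)) (hn fun b hb => ?_))
      (sum_mem fun c hc => Submodule.smul_of_tower_mem _ _ (hrK c hc))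
    rw [map_sub, MvPolynomial.coeff_coe, hq, MvPowerSeries.coeff_truncTotal _ hb, sub_self]

/-- A normal form of a monomial of degree at least `n` has only monomials of degree at least `n`,
all of them leading, so it is zero. Hence `orderIdeal σ k n` lies in `J` plus the maximal ideal
times itself, and Nakayama's lemma applies. -/
theorem orderIdeal_le [Finite σ] {J : Ideal (MvPowerSeries σ k)} {n : ℕ}
    (hn : ∀ a : σ →₀ ℕ, n ≤ a.degree →
      a ∈ localLeadingExps τ (J : Set (MvPowerSeries σ k))) :
    orderIdeal σ k n ≤ J := by
  classical
  have hmon : ∀ a : σ →₀ ℕ, n ≤ a.degree →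
      MvPowerSeries.monomial a (1 : k) ∈ J ⊔ orderIdeal σ k (n + 1) := by
    intro a ha
    obtain ⟨r, hr, hrK⟩ := exists_normalForm_monomial (τ := τ) (J := J)
      (K := J ⊔ orderIdeal σ k (n + 1)) le_sup_left le_sup_right a
    have : r = 0 := by
      ext c
      by_contra hc
      obtain ⟨h1, h2⟩ := hr c hc
      refine h1 (hn c ?_)
      rcases h2 with rfl | h2 | ⟨h2, -⟩ <;> omega
    simpa [this] using hrK
  refine Submodule.le_of_le_smul_of_le_jacobson_bot (IsNoetherian.noetherian _)
    (IsLocalRing.jacobson_eq_maximalIdeal ⊥ bot_ne_top).ge ?_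
  refine le_trans ?_ (sup_le_sup_left (orderIdeal_succ_le n) J)
  intro f hf
  have hsplit : f = (f - (MvPowerSeries.truncTotal (n + 1) f : MvPolynomial σ k)) +
      (MvPowerSeries.truncTotal (n + 1) f : MvPolynomial σ k) := by abel
  rw [hsplit]
  refine add_mem (Ideal.mem_sup_right fun b hb => ?_) ?_
  · rw [map_sub, MvPolynomial.coeff_coe, MvPowerSeries.coeff_truncTotal _ hb, sub_self]
  · set q := MvPowerSeries.truncTotal (n + 1) f with hq
    rw [q.as_sum, ← MvPolynomial.coeToMvPowerSeries.ringHom_apply, map_sum]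
    refine sum_mem fun c hc => ?_
    rw [MvPolynomial.coeToMvPowerSeries.ringHom_apply, MvPolynomial.coe_monomial,
      ← mul_one (q.coeff c), ← smul_eq_mul, map_smul]
    refine Submodule.smul_of_tower_mem _ _ (hmon c ?_)
    by_contra hcn
    rw [MvPolynomial.mem_support_iff, hq, MvPowerSeries.coeff_truncTotal_eq_ite] at hc
    split_ifs at hc
    · exact hc (hf c (by omega))
    · exact hc rfl

theorem exists_reduced_polynomial [Finite σ] {J : Ideal (MvPowerSeries σ k)} {n : ℕ}
    (hn : ∀ a : σ →₀ ℕ, n ≤ a.degree →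
      a ∈ localLeadingExps τ (J : Set (MvPowerSeries σ k))) {e : σ →₀ ℕ}
    (he : e ∈ localLeadingExps τ (J : Set (MvPowerSeries σ k))) :
    ∃ p : MvPolynomial σ k, (p : MvPowerSeries σ k) ∈ J ∧ p.coeff e = 1 ∧
      ∀ c, p.coeff c ≠ 0 → c ≠ e →
        c ∉ localLeadingExps τ (J : Set (MvPowerSeries σ k)) ∧ LocalLT τ c e := by
  classical
  obtain ⟨r, hr, hrJ⟩ := exists_normalForm_monomial (τ := τ) le_rfl (orderIdeal_le hn) e
  refine ⟨MvPolynomial.monomial e 1 - r, ?_, ?_, fun c hc hne => ?_⟩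
  · rw [← MvPolynomial.coeToMvPowerSeries.ringHom_apply, map_sub]
    simpa using hrJ
  · have : r.coeff e = 0 := by
      by_contra h
      exact (hr e h).1 he
    simp [this]
  · have hrc : r.coeff c ≠ 0 := by
      simpa [MvPolynomial.coeff_monomial, Ne.symm hne] using hc
    obtain ⟨h1, h2⟩ := hr c hrc
    exact ⟨h1, h2.resolve_left hne⟩

/-- The reduced enhanced standard basis is the set of the reduced elements that belong to the
minimal leading exponents. -/
theorem isReducedEnhancedStandardBasis_iff [Finite σ] [DecidableEq (MvPowerSeries σ k)]
    {J : Ideal (MvPowerSeries σ k)} {M : Finset (σ →₀ ℕ)}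
    (hM : ∀ e, e ∈ M ↔ Minimal (· ∈ localLeadingExps τ (J : Set (MvPowerSeries σ k))) e)
    {p : (σ →₀ ℕ) → MvPowerSeries σ k} (hpJ : ∀ e ∈ M, p e ∈ J)
    (hpe : ∀ e ∈ M, MvPowerSeries.coeff e (p e) = 1)
    (hp : ∀ e ∈ M, ∀ c, MvPowerSeries.coeff c (p e) ≠ 0 → c ≠ e →
      c ∉ localLeadingExps τ (J : Set (MvPowerSeries σ k)) ∧ LocalLT τ c e)
    (F : Finset (MvPowerSeries σ k)) :
    IsReducedEnhancedStandardBasis τ J F ↔ F = M.image p := by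
  have hlead : ∀ e ∈ M, IsLocalLeadingExp τ (p e) e := fun e he =>
    ⟨by rw [hpe e he]; exact one_ne_zero, fun c hc hne => (hp e he c hc hne).2⟩
  have hmin : ∀ a ∈ localLeadingExps τ (J : Set (MvPowerSeries σ k)), ∃ e ∈ M, e ≤ a := by
    intro a ha
    obtain ⟨e, hea, he⟩ := exists_minimal_le_of_wellFoundedLT
      (· ∈ localLeadingExps τ (J : Set (MvPowerSeries σ k))) a ha
    exact ⟨e, (hM e).mpr he, hea⟩
  constructor
  · rintro ⟨⟨hFJ, hFE⟩, hF1, hF2, hF3⟩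
    have hgen : ∀ a ∈ localLeadingExps τ (J : Set (MvPowerSeries σ k)),
        ∃ f ∈ F, ∃ e, IsLocalLeadingExp τ f e ∧ e ≤ a := by
      intro a ha
      have h : MvPolynomial.monomial a (1 : k) ∈
          localLeadingIdeal τ (F : Set (MvPowerSeries σ k)) := by
        rw [hFE, localLeadingIdeal_eq_span]
        exact Ideal.subset_span ⟨a, ha, rfl⟩
      rw [localLeadingIdeal_eq_span, monomial_mem_span_monomial_image] at h
      obtain ⟨e, ⟨f, hf, hfe⟩, hea⟩ := h
      exact ⟨f, hf, e, hfe, hea⟩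
    -- In `f - p e` the two terms at `e` cancel, and neither tail meets the leading exponents of
    -- `J`.
    have heq : ∀ f ∈ F, ∀ e ∈ M, IsLocalLeadingExp τ f e → f = p e := by
      intro f hf e he hfe
      obtain ⟨e', hfe', h1⟩ := hF1 f hf
      obtain rfl := hfe.unique hfe'
      rw [← sub_eq_zero]
      refine eq_zero_of_support_disjoint (τ := τ) (sub_mem (hFJ f hf) (hpJ e he))
        fun c hc hcS => ?_
      have hce : c ≠ e := by
        rintro rfl
        exact hc (by rw [map_sub, h1, hpe c he, sub_self])
      have hpc : MvPowerSeries.coeff c (p e) = 0 := by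
        by_contra h
        exact (hp e he c h hce).1 hcS
      rw [map_sub, hpc, sub_zero] at hc
      obtain ⟨g, hg, b, hgb, hbc⟩ := hgen c hcS
      exact hF3 f hf g hg e b hfe hgb c hc hce hbc
    ext f
    rw [Finset.mem_image]
    constructor
    · intro hf
      obtain ⟨a, hfa, -⟩ := hF1 f hf
      have haS : a ∈ localLeadingExps τ (J : Set (MvPowerSeries σ k)) := ⟨f, hFJ f hf, hfa⟩
      have haM : a ∈ M := by
        rw [hM]
        refine ⟨haS, fun b hb hba => ?_⟩
        obtain ⟨g, hg, c, hgc, hcb⟩ := hgen b hb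
        by_cases hfg : f = g
        · subst hfg
          exact (hfa.unique hgc).trans_le hcb
        · exact absurd (hcb.trans hba) (hF2 f hf g hg hfg a c hfa hgc)
      exact ⟨a, haM, (heq f hf a haM hfa).symm⟩
    · rintro ⟨e, he, rfl⟩
      have heM := (hM e).mp he
      obtain ⟨f, hf, a, hfa, hae⟩ := hgen e heM.1
      obtain rfl : a = e := le_antisymm hae (heM.2 ⟨f, hFJ f hf, hfa⟩ hae)
      rwa [← heq f hf a he hfa]
  · rintro rfl
    refine ⟨⟨fun f hf => ?_, ?_⟩, fun f hf => ?_, fun f hf g hg hfg a b hfa hgb hba => ?_,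
      fun f hf g hg a b hfa hgb c hc hca hbc => ?_⟩
    · obtain ⟨e, he, rfl⟩ := Finset.mem_image.mp hf
      exact hpJ e he
    · rw [localLeadingIdeal_eq_span, localLeadingIdeal_eq_span]
      refine le_antisymm (Ideal.span_mono (Set.image_mono ?_)) (Ideal.span_le.mpr ?_)
      · rintro a ⟨f, hf, hfa⟩
        obtain ⟨e, he, rfl⟩ := Finset.mem_image.mp hf
        exact ⟨p e, hpJ e he, hfa⟩
      · rintro _ ⟨a, ha, rfl⟩
        obtain ⟨e, he, hea⟩ := hmin a ha
        exact monomial_mem_span_monomial_image.mpr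
          ⟨e, ⟨p e, Finset.mem_image_of_mem p he, hlead e he⟩, hea⟩
    · obtain ⟨e, he, rfl⟩ := Finset.mem_image.mp hf
      exact ⟨e, hlead e he, hpe e he⟩
    · obtain ⟨e, he, rfl⟩ := Finset.mem_image.mp hf
      obtain ⟨e', he', rfl⟩ := Finset.mem_image.mp hg
      obtain rfl := (hlead e he).unique hfa
      obtain rfl := (hlead e' he').unique hgb
      exact hfg (by rw [le_antisymm hba (((hM e).mp he).2 ((hM e').mp he').1 hba)])
    · obtain ⟨e, he, rfl⟩ := Finset.mem_image.mp hf
      obtain ⟨e', he', rfl⟩ := Finset.mem_image.mp hg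
      obtain rfl := (hlead e he).unique hfa
      obtain rfl := (hlead e' he').unique hgb
      exact (hp e he c hc hca).1 (isUpperSet_localLeadingExps J hbc ((hM e').mp he').1)

end General

/-! ### Division by a basis whose leading monomials agree for two orders -/

section General

variable {σ k : Type*} [Field k] {τ : MonomialOrder σ}

theorem mem_contraction {J : Ideal (MvPowerSeries σ k)} {f : MvPolynomial σ k} :
    f ∈ contraction J ↔ (f : MvPowerSeries σ k) ∈ J := Iff.rfl

/-- If the leading monomials for the term order `τ` of a family of polynomials in `J` generate all
local leading monomials of `J`, for a local order that may differ from `τ`, then the leading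
monomials for `τ` of the elements of `J ∩ P` are local leading monomials of `J`. -/
theorem degree_mem_localLeadingExps [Finite σ] {τ' : MonomialOrder σ}
    {J : Ideal (MvPowerSeries σ k)} {M : Set (σ →₀ ℕ)}
    (hMS : M ⊆ localLeadingExps τ' (J : Set (MvPowerSeries σ k)))
    (hM : ∀ a ∈ localLeadingExps τ' (J : Set (MvPowerSeries σ k)), ∃ e ∈ M, e ≤ a)
    {p : (σ →₀ ℕ) → MvPolynomial σ k} (hpJ : ∀ e ∈ M, (p e : MvPowerSeries σ k) ∈ J)
    (hp1 : ∀ e ∈ M, τ.Monic (p e)) (hpd : ∀ e ∈ M, τ.degree (p e) = e)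
    {f : MvPolynomial σ k} (hf : f ∈ contraction J) (hf0 : f ≠ 0) :
    τ.degree f ∈ localLeadingExps τ' (J : Set (MvPowerSeries σ k)) := by
  classical
  obtain ⟨g, r, hfr, hdeg, hr⟩ := τ.div (b := fun e : M => p e)
    (fun e => by rw [(hp1 e e.2).leadingCoeff_eq_one]; exact isUnit_one) f
  have hlin : Finsupp.linearCombination (MvPolynomial σ k) (fun e : M => p e) g ∈
      contraction J := by
    rw [Finsupp.linearCombination_apply]
    exact sum_mem fun e _ => Ideal.mul_mem_left _ _ (mem_contraction.mpr (hpJ e e.2))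
  have hrJ : r ∈ contraction J := by
    rw [eq_sub_of_add_eq' hfr.symm]
    exact sub_mem hf hlin
  have hr0 : r = 0 := by
    have h := eq_zero_of_support_disjoint (τ := τ') (mem_contraction.mp hrJ) fun c hc hcS => by
      obtain ⟨e, he, hec⟩ := hM c hcS
      rw [MvPolynomial.coeff_coe] at hc
      exact hr c (MvPolynomial.mem_support_iff.mpr hc) ⟨e, he⟩ (by rwa [hpd e he])
    exact MvPolynomial.coe_injective _ _ (by simpa using h)
  rw [hr0, add_zero, Finsupp.linearCombination_apply, Finsupp.sum] at hfr
  -- No product in the division exceeds `τ.degree f`, so one with a nonzero coefficient there has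
  -- exactly that degree, which is then a multiple of some `e`.
  have hc : MvPolynomial.coeff (τ.degree f) (∑ e ∈ g.support, g e • p e) ≠ 0 := by
    rw [← hfr]
    exact τ.coeff_degree_ne_zero_iff.mpr hf0
  rw [MvPolynomial.coeff_sum] at hc
  obtain ⟨e, -, he⟩ := Finset.exists_ne_zero_of_sum_ne_zero hc
  rw [smul_eq_mul, mul_comm] at he
  have heq : τ.degree f = τ.degree (p e * g e) :=
    τ.toSyn.injective (le_antisymm (τ.le_degree (MvPolynomial.mem_support_iff.mpr he)) (hdeg e))
  have hge : g e ≠ 0 := by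
    intro h
    simp [h] at he
  rw [heq, τ.degree_mul (hp1 e e.2).ne_zero hge, hpd e e.2]
  exact isUpperSet_localLeadingExps J le_self_add (hMS e.2)

end General

/-! ### Staircases in two variables and the slope condition -/

/-- The exponents of the generators of `stairIdeal`. -/
noncomputable def stairExp (t : ℕ) (m : Fin (t + 1) → ℕ) (i : Fin (t + 1)) : Fin 2 →₀ ℕ :=
  Finsupp.single 0 (t - (i : ℕ)) + Finsupp.single 1 (m i)

theorem stairIdeal_eq_span (k : Type*) [Field k] (t : ℕ) (m : Fin (t + 1) → ℕ) :
    stairIdeal k t m = Ideal.span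
      ((fun s => MvPolynomial.monomial s (1 : k)) '' Set.range (stairExp t m)) := by
  rw [stairIdeal, ← Set.range_comp]
  congr 2
  funext i
  simp [stairExp, MvPolynomial.X_pow_eq_monomial, MvPolynomial.monomial_mul]

theorem stairExp_le_iff {t : ℕ} {m : Fin (t + 1) → ℕ} {i : Fin (t + 1)} {a : Fin 2 →₀ ℕ} :
    stairExp t m i ≤ a ↔ t - (i : ℕ) ≤ a 0 ∧ m i ≤ a 1 := by
  rw [Finsupp.le_def, Fin.forall_fin_two]
  simp [stairExp]

theorem degree_fin_two (a : Fin 2 →₀ ℕ) : a.degree = a 0 + a 1 := by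
  simp [Finsupp.degree_eq_sum, Fin.sum_univ_two]

theorem lex_fin_two {a b : Fin 2 →₀ ℕ} :
    (MonomialOrder.lex (σ := Fin 2)).toSyn a < (MonomialOrder.lex (σ := Fin 2)).toSyn b ↔
      a 0 < b 0 ∨ a 0 = b 0 ∧ a 1 < b 1 := by
  rw [MonomialOrder.lex_lt_iff, Finsupp.Lex.lt_iff, Fin.exists_fin_two]
  simp

/-- Under the slope condition on `m`, a monomial outside the staircase that is smaller than a
generator for the local lex order is smaller than it for the lex order. -/
theorem lex_lt_stairExp {t : ℕ} {m : Fin (t + 1) → ℕ} (hm0 : m 0 = 0)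
    (hcond : ∀ i j : Fin (t + 1), j < i →
      (m j : ℤ) - ((j : ℕ) : ℤ) - 1 ≤ (m i : ℤ) - ((i : ℕ) : ℤ))
    {i : Fin (t + 1)} {c : Fin 2 →₀ ℕ} (hc : ∀ j, ¬ stairExp t m j ≤ c)
    (hlt : LocalLT MonomialOrder.lex c (stairExp t m i)) :
    MonomialOrder.lex.toSyn c < MonomialOrder.lex.toSyn (stairExp t m i) := by
  rcases hlt with hlt | ⟨-, hlt⟩
  swap
  · exact hlt
  simp only [stairExp_le_iff, not_and, not_le] at hc
  have h0 : stairExp t m i 0 = t - (i : ℕ) := by simp [stairExp]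
  have h1 : stairExp t m i 1 = m i := by simp [stairExp]
  rw [degree_fin_two, degree_fin_two, h0, h1] at hlt
  rw [lex_fin_two, h0, h1]
  by_contra! hcon
  have hi : (i : ℕ) ≤ t := Nat.le_of_lt_succ i.2
  have hct : c 0 < t := by
    by_contra! h
    have := hc 0 (by simpa using h)
    omega
  have hji : t - c 0 ≤ i := by omega
  -- The generator with the same `x`-exponent as `c`; as `c` is outside the staircase, `c 1 < m j`.
  -- For `j < i` the slope condition gives `deg c ≤ t - j + m j - 1 ≤ t - i + m i`, against the
  -- strict degree inequality `hlt`.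
  let j : Fin (t + 1) := ⟨t - c 0, by omega⟩
  have hj : (j : ℕ) = t - c 0 := rfl
  have hcj := hc j (by omega)
  rcases hji.lt_or_eq with h | h
  · have := hcond i j h
    omega
  · have : j = i := Fin.ext h
    rw [this] at hcj
    have := hcon.2 (by omega)
    omega

theorem mem_localLeadingExps_iff {k : Type*} [Field k] {t : ℕ} {m : Fin (t + 1) → ℕ}
    {J : Ideal (MvPowerSeries (Fin 2) k)} (hJ : J ∈ cellV (stairIdeal k t m)) {a : Fin 2 →₀ ℕ} :
    a ∈ localLeadingExps MonomialOrder.lex (J : Set (MvPowerSeries (Fin 2) k)) ↔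
      ∃ i, stairExp t m i ≤ a := by
  have hJ' : localLeadingIdeal MonomialOrder.lex (J : Set (MvPowerSeries (Fin 2) k)) =
    stairIdeal k t m := hJ
  rw [localLeadingIdeal_eq_span, stairIdeal_eq_span] at hJ'
  have h := monomial_mem_span_monomial_image (k := k)
    (S := localLeadingExps MonomialOrder.lex (J : Set (MvPowerSeries (Fin 2) k))) (a := a)
  rw [hJ', monomial_mem_span_monomial_image, Set.exists_range_iff] at h
  rw [h]
  exact ⟨fun ha => ⟨a, ha, le_rfl⟩, fun ⟨b, hb, hba⟩ => isUpperSet_localLeadingExps J hba hb⟩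

theorem mem_localLeadingExps_of_le_degree {k : Type*} [Field k] {t : ℕ} {m : Fin (t + 1) → ℕ}
    (hm0 : m 0 = 0) {J : Ideal (MvPowerSeries (Fin 2) k)} (hJ : J ∈ cellV (stairIdeal k t m))
    {a : Fin 2 →₀ ℕ} (ha : t + m (Fin.last t) ≤ a.degree) :
    a ∈ localLeadingExps MonomialOrder.lex (J : Set (MvPowerSeries (Fin 2) k)) := by
  rw [mem_localLeadingExps_iff hJ]
  rw [degree_fin_two] at ha
  rcases le_total t (a 0) with h | h
  · exact ⟨0, stairExp_le_iff.mpr ⟨by simpa using h, by simp [hm0]⟩⟩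
  · exact ⟨Fin.last t, stairExp_le_iff.mpr ⟨by simp, by omega⟩⟩

theorem mainTheorem5 {k : Type*} [Field k] (t : ℕ) (m : Fin (t + 1) → ℕ)
    (hm0 : m 0 = 0) (hmpos : ∀ i, 0 < i → 0 < m i) (hmono : Monotone m)
    (hcond : ∀ i j : Fin (t + 1), j < i →
      (m j : ℤ) - ((j : ℕ) : ℤ) - 1 ≤ (m i : ℤ) - ((i : ℕ) : ℤ))
    (J : Ideal (MvPowerSeries (Fin 2) k)) (hJ : J ∈ cellV (stairIdeal k t m)) :
    (∃! F : Finset (MvPowerSeries (Fin 2) k),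
      IsReducedEnhancedStandardBasis MonomialOrder.lex J F) ∧
    (∀ F : Finset (MvPowerSeries (Fin 2) k),
      IsReducedEnhancedStandardBasis MonomialOrder.lex J F →
      ∃ G : Finset (MvPolynomial (Fin 2) k),
        (fun p : MvPolynomial (Fin 2) k => (p : MvPowerSeries (Fin 2) k)) ''
            (G : Set (MvPolynomial (Fin 2) k)) = (F : Set (MvPowerSeries (Fin 2) k)) ∧
        IsGroebnerBasis MonomialOrder.lex (contraction J) G) ∧
    leadingIdeal MonomialOrder.lex (contraction J) = stairIdeal k t m := by
  classical
  set S := localLeadingExps MonomialOrder.lex (J : Set (MvPowerSeries (Fin 2) k)) with hS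
  -- Finiteness is Dickson's lemma. Minimal exponents are used because a generator of `E` is
  -- redundant when `m i = m (i + 1)`.
  have hMfin : {e | Minimal (· ∈ S) e}.Finite :=
    WellQuasiOrderedLE.finite_of_isAntichain (setOfPred_minimal_antichain _)
  set M := hMfin.toFinset with hMdef
  have hM : ∀ e, e ∈ M ↔ Minimal (· ∈ S) e := fun e => by simp [hMdef]
  have hMS : ∀ e ∈ M, e ∈ S := fun e he => ((hM e).mp he).1
  have hmin : ∀ a ∈ S, ∃ e ∈ M, e ≤ a := by
    intro a ha
    obtain ⟨e, hea, he⟩ := exists_minimal_le_of_wellFoundedLT (· ∈ S) a ha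
    exact ⟨e, (hM e).mpr he, hea⟩
  have hex := fun e (he : e ∈ M) => exists_reduced_polynomial
    (fun a => mem_localLeadingExps_of_le_degree hm0 hJ) (hMS e he)
  choose! p hpJ hpe hp using hex
  have hiff := isReducedEnhancedStandardBasis_iff hM (p := fun e => (p e : MvPowerSeries (Fin 2) k))
    hpJ (fun e he => by rw [MvPolynomial.coeff_coe, hpe e he])
    (fun e he c hc hce => hp e he c (by rwa [MvPolynomial.coeff_coe] at hc) hce)
  have hdeg : ∀ e ∈ M, MonomialOrder.lex.degree (p e) = e := by
    intro e he
    apply MonomialOrder.lex.toSyn.injective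
    refine le_antisymm (MonomialOrder.lex.degree_le_iff.mpr fun c hc => ?_)
      (MonomialOrder.lex.le_degree (MvPolynomial.mem_support_iff.mpr ?_))
    · by_cases hce : c = e
      · rw [hce]
      obtain ⟨h1, h2⟩ := hp e he c (MvPolynomial.mem_support_iff.mp hc) hce
      obtain ⟨i, hi⟩ := (mem_localLeadingExps_iff hJ).mp (hMS e he)
      -- A minimal exponent is one of the staircase generators, so the slope condition applies to
      -- it.
      have hie : stairExp t m i = e := le_antisymm hi
        (((hM e).mp he).2 ((mem_localLeadingExps_iff hJ).mpr ⟨i, le_rfl⟩) hi)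
      rw [← hie] at h2 ⊢
      exact (lex_lt_stairExp hm0 hcond
        (fun j hj => h1 ((mem_localLeadingExps_iff hJ).mpr ⟨j, hj⟩)) h2).le
    · rw [hpe e he]
      exact one_ne_zero
  have hmonic : ∀ e ∈ M, MonomialOrder.lex.Monic (p e) := by
    intro e he
    rw [MonomialOrder.Monic, MonomialOrder.leadingCoeff, hdeg e he, hpe e he]
  have hG : ∀ g ∈ M.image p, g ∈ contraction J := by
    intro g hg
    obtain ⟨e, he, rfl⟩ := Finset.mem_image.mp hg
    exact hpJ e he
  -- `h1`, `h2` and `h3` close a cycle of inclusions among `E`, the span of the lex leading terms of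
  -- the basis, and the lex leading ideal of `I`, so all three coincide.
  have h1 : stairIdeal k t m ≤ Ideal.span
      (MonomialOrder.lex.leadingTerm '' (M.image p : Set (MvPolynomial (Fin 2) k))) := by
    rw [stairIdeal_eq_span, Ideal.span_le]
    rintro _ ⟨_, ⟨i, rfl⟩, rfl⟩
    obtain ⟨e, he, hei⟩ := hmin _ ((mem_localLeadingExps_iff hJ).mpr ⟨i, le_rfl⟩)
    have hle := monomial_mem_span_monomial_image (k := k) (S := (M : Set (Fin 2 →₀ ℕ)))
      |>.mpr ⟨e, he, hei⟩
    refine Ideal.span_mono ?_ hle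
    rintro _ ⟨b, hb, rfl⟩
    refine ⟨p b, Finset.mem_coe.mpr (Finset.mem_image_of_mem p hb), ?_⟩
    rw [MonomialOrder.leadingTerm, hdeg b hb, (hmonic b hb).leadingCoeff_eq_one]
  have h2 : Ideal.span
      (MonomialOrder.lex.leadingTerm '' (M.image p : Set (MvPolynomial (Fin 2) k))) ≤
      leadingIdeal MonomialOrder.lex (contraction J) :=
    Ideal.span_mono (Set.image_mono hG)
  have h3 : leadingIdeal MonomialOrder.lex (contraction J) ≤ stairIdeal k t m := by
    rw [leadingIdeal, Ideal.span_le]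
    rintro _ ⟨f, hf, rfl⟩
    by_cases hf0 : f = 0
    · simp [hf0]
    have hfS := degree_mem_localLeadingExps (τ := MonomialOrder.lex) (M := (M : Set _))
      (fun e he => hMS e he) hmin hpJ hmonic hdeg hf hf0
    have hmem : MvPolynomial.monomial (MonomialOrder.lex.degree f) (1 : k) ∈ stairIdeal k t m := by
      rw [stairIdeal_eq_span, monomial_mem_span_monomial_image, Set.exists_range_iff]
      exact (mem_localLeadingExps_iff hJ).mp hfS
    rw [← MonomialOrder.C_mul_leadingCoeff_monomial_degree]
    exact Ideal.mul_mem_left _ _ hmem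
  refine ⟨⟨_, (hiff _).mpr rfl, fun F hF => (hiff F).mp hF⟩, fun F hF => ⟨M.image p, ?_, hG, ?_⟩,
    le_antisymm h3 (h1.trans h2)⟩
  · rw [(hiff F).mp hF, Finset.coe_image, Finset.coe_image, Set.image_image]
  · exact le_antisymm h2 (h3.trans h1)
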